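/- Let $c\in\mathbb R$, let $k\ge 1$ be an integer, let $\mu>0$, $c_a^2\ge 0$, $c_s^2\ge 0$ with $c_x^2:=c_a^2+c_s^2>0$, and let $F^{(k)}(0)>0$; write $\Xi=(c,k,\mu,c_a^2,c_s^2,F^{(k)}(0))$ and $\beta:=F^{(k)}(0)/k!$. Let $B_a,B_s$ be independent standard Brownian motions, and let $Z^*(0)$ be independent of $(B_a,B_s)$ with the stationary density $$\pi_k(x)=\frac1{G_k}\exp\Bigl\{\frac{2\mu}{c_x^2}\Bigl(cx-\frac{F^{(k)}(0)}{(k+1)!}x^{k+1}\Bigr)\Bigr\}\mathbf 1\{x\ge 0\},$$ where $G_k$ is the normalizing constant. Let $(Z^*,L^*)$ be the continuous solution of the reflected equation $$Z^*(t)=Z^*(0)+\mu^{-1}c_aB_a(\mu t)+\mu^{-1}c_sB_s(\mu t)-\beta\int_0^t Z^*(s)^k\,ds+ct+L^*(t),\qquad t\ge 0,$$ with $Z^*\ge 0$, $L^*$ nondecreasing, $L^*(0)=0$ and $\int_0^\infty \mathbf 1\{Z^*(t)>0\}\,dL^*(t)=0$. Put $Y^*(t):=Z^*(t)-Z^*(0)-ct-L^*(t)$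 (the total input process) and $v(t;\Xi):=\mathrm{Var}(Y^*(t))$ for $t\ge 0$. For $c'\in\mathbb R$ put $v_{c',k}(t):=v(t;c',k,1,1,1,k!)$, $w_{c',k}(t):=v_{c',k}(t)/(2t)$ for $t>0$, and $w_{c',k}(0):=1$. Define $$\tau:=\Bigl(\frac{c_x^2}{2\mu}\Bigr)^{\frac{k-1}{k+1}}\beta^{\frac{2}{k+1}},\qquad \tilde c:=c\Bigl(\frac{c_x^2}{2\mu}\Bigr)^{-\frac{k}{k+1}}\beta^{-\frac1{k+1}}.$$ Then, for all $t\ge 0$, $Y^*(t)$ is square integrable and $$v(t;\Xi)=\frac{c_x^2}{\mu}\,t\,w_{\tilde c,k}(\tau t).$$ The identity holds whichever realizations (on whichever probability spaces) of the stationary diffusions with parameters $\Xi$ and $(\tilde c,k,1,1,1,k!)$ are used to compute the two sides. -/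

import Mathlib

open MeasureTheory ProbabilityTheory
open scoped NNReal

namespace HeavyTraffic

noncomputable section

/-- The parameter tuple `(c, k, μ, c_a², c_s², F^{(k)}(0))` of the heavy-traffic limit. -/
structure ParamTuple where
  c : ℝ
  k : ℕ
  μ : ℝ
  caSq : ℝ
  csSq : ℝ
  Fk : ℝ

namespace ParamTuple

/-- The standing restrictions on the parameters: `k ≥ 1`, `μ > 0`, `c_a², c_s² ≥ 0` and not both
zero, and `F^{(k)}(0) > 0`. -/
structure Admissible (Ξ : ParamTuple) : Prop where
  one_le_k : 1 ≤ Ξ.k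
  μ_pos : 0 < Ξ.μ
  caSq_nonneg : 0 ≤ Ξ.caSq
  csSq_nonneg : 0 ≤ Ξ.csSq
  cxSq_pos : 0 < Ξ.caSq + Ξ.csSq
  Fk_pos : 0 < Ξ.Fk

/-- The total variability parameter `c_x² = c_a² + c_s²`. -/
def cxSq (Ξ : ParamTuple) : ℝ := Ξ.caSq + Ξ.csSq

/-- The drift coefficient `β = F^{(k)}(0) / k!`. -/
def β (Ξ : ParamTuple) : ℝ := Ξ.Fk / (Nat.factorial Ξ.k : ℝ)

/-- The base parameter tuple `(c, k, 1, 1, 1, k!)`. -/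
def base (c : ℝ) (k : ℕ) : ParamTuple where
  c := c
  k := k
  μ := 1
  caSq := 1
  csSq := 1
  Fk := (Nat.factorial k : ℝ)

/-- `τ = (c_x² / (2μ))^{(k-1)/(k+1)} β^{2/(k+1)}`. -/
def τ (Ξ : ParamTuple) : ℝ :=
  (Ξ.cxSq / (2 * Ξ.μ)) ^ (((Ξ.k : ℝ) - 1) / ((Ξ.k : ℝ) + 1)) * Ξ.β ^ (2 / ((Ξ.k : ℝ) + 1))

/-- `c̃ = c (c_x² / (2μ))^{-k/(k+1)} β^{-1/(k+1)}`. -/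
def cTilde (Ξ : ParamTuple) : ℝ :=
  Ξ.c * (Ξ.cxSq / (2 * Ξ.μ)) ^ (-((Ξ.k : ℝ) / ((Ξ.k : ℝ) + 1))) *
    Ξ.β ^ (-(1 / ((Ξ.k : ℝ) + 1)))

/-- The function `exp{(2μ/c_x²) (c x - F^{(k)}(0)/(k+1)! x^{k+1})}`. -/
def stationaryWeight (Ξ : ParamTuple) (x : ℝ) : ℝ :=
  Real.exp (2 * Ξ.μ / Ξ.cxSq *
    (Ξ.c * x - Ξ.Fk / (Nat.factorial (Ξ.k + 1) : ℝ) * x ^ (Ξ.k + 1)))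

/-- The stationary density of the reflected diffusion: the weight above, normalized to have
integral one on `[0, ∞)`, and zero on the negative half-line. -/
def stationaryDensity (Ξ : ParamTuple) : ℝ → ℝ :=
  (Set.Ici 0).indicator fun x ↦ Ξ.stationaryWeight x / ∫ y in Set.Ici 0, Ξ.stationaryWeight y

/-- The stationary distribution of the reflected diffusion. -/
def stationaryLaw (Ξ : ParamTuple) : Measure ℝ :=
  volume.withDensity fun x ↦ ENNReal.ofReal (Ξ.stationaryDensity x)

end ParamTuple

/-- A path `z`, with regulator `l`, solves the reflected integral equation
`z(t) = x(t) - β ∫₀ᵗ z(s)^k ds + c t + l(t)`, `t ≥ 0`: `z` and `l` are continuous, `z ≥ 0`, `l` is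
nondecreasing with `l(0) = 0`, and `∫₀^∞ 1{z(t) > 0} dl(t) = 0`, i.e. the Lebesgue-Stieltjes
measure of `l` gives no mass to the set where `z` is positive. -/
structure IsReflectedSolution (c β : ℝ) (k : ℕ) (x z l : ℝ≥0 → ℝ) : Prop where
  continuous_z : Continuous z
  continuous_l : Continuous l
  nonneg : ∀ t, 0 ≤ z t
  mono : Monotone l
  l_zero : l 0 = 0
  eqn : ∀ t : ℝ≥0,
    z t = x t - β * (∫ s in (0 : ℝ)..t, z s.toNNReal ^ k) + c * t + l t
  complementarity : mono.stieltjesFunction.measure {t | 0 < z t} = 0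

/-- A realization, on a probability space `(Ω, P)`, of the stationary reflected diffusion
`(Z*, L*)` with parameter tuple `Ξ`: there are independent standard Brownian motions `B_a`, `B_s`
and an initial state `Z*(0)`, independent of them and following the stationary distribution, such
that almost surely, for all `t ≥ 0`,
`Z*(t) = Z*(0) + μ⁻¹ c_a B_a(μ t) + μ⁻¹ c_s B_s(μ t) - β ∫₀ᵗ Z*(s)^k ds + c t + L*(t)`
and `L*` is the regulator of `Z*` at `0`. -/
structure StationaryDiffusion (Ξ : ParamTuple) {Ω : Type*} [MeasurableSpace Ω]
    (P : Measure Ω) where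
  Ba : ℝ≥0 → Ω → ℝ
  Bs : ℝ≥0 → Ω → ℝ
  Z : ℝ≥0 → Ω → ℝ
  L : ℝ≥0 → Ω → ℝ
  measurable_Ba : ∀ t, Measurable (Ba t)
  measurable_Bs : ∀ t, Measurable (Bs t)
  measurable_Z : ∀ t, Measurable (Z t)
  measurable_L : ∀ t, Measurable (L t)
  brownian_Ba : IsBrownianReal Ba P
  brownian_Bs : IsBrownianReal Bs P
  indep_Ba_Bs : IndepFun (fun ω t ↦ Ba t ω) (fun ω t ↦ Bs t ω) P
  indep_initial : IndepFun (Z 0) (fun ω ↦ ((fun t ↦ Ba t ω), (fun t ↦ Bs t ω))) P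
  law_initial : HasLaw (Z 0) Ξ.stationaryLaw P
  solution : ∀ᵐ ω ∂P, IsReflectedSolution Ξ.c Ξ.β Ξ.k
    (fun t ↦ Z 0 ω + Ξ.μ⁻¹ * √Ξ.caSq * Ba (Ξ.μ * t).toNNReal ω
      + Ξ.μ⁻¹ * √Ξ.csSq * Bs (Ξ.μ * t).toNNReal ω)
    (fun t ↦ Z t ω) (fun t ↦ L t ω)

namespace StationaryDiffusion

variable {Ξ : ParamTuple} {Ω : Type*} [MeasurableSpace Ω] {P : Measure Ω}

/-- The total effective input `Y*(t) = Z*(t) - Z*(0) - c t - L*(t)`, `t ≥ 0`. -/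
def Y (S : StationaryDiffusion Ξ P) (t : ℝ) (ω : Ω) : ℝ :=
  S.Z t.toNNReal ω - S.Z 0 ω - Ξ.c * t - S.L t.toNNReal ω

/-- The variance function `v(t; Ξ) = Var(Y*(t))`, `t ≥ 0`. -/
def v (S : StationaryDiffusion Ξ P) (t : ℝ) : ℝ := variance (S.Y t) P

/-- The variance-reduction function `w_{c,k}(t) = v_{c,k}(t) / (2t)` for `t > 0`, with
`w_{c,k}(0) = 1`; here `v_{c,k}` is the variance function of the base tuple. -/
def w {c : ℝ} {k : ℕ} (S : StationaryDiffusion (ParamTuple.base c k) P) (t : ℝ) : ℝ :=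
  if t = 0 then 1 else S.v t / (2 * t)

end StationaryDiffusion

end

end HeavyTraffic

/-!
The proof reduces both sides to one normalized diffusion. With `σ = c_x² / (2μ)` and
`a = (β / σ)^{1/(k+1)}` one has `τ = σ a²`, and the process `s ↦ a Z*(s / τ)` solves the reflected
equation with parameters `(c̃, k, 1, 1, 1, k!)`: the drift coefficient becomes `β a^{1-k} / τ = 1`,
the linear drift `c a / τ = c̃`, and the two Brownian terms merge into `√2 W` for a single standard
Brownian motion `W` (`StationaryDiffusion.exists_isNormalizedDiffusion`). The stationary law is
carried along (`ParamTuple.Admissible.map_stationaryLaw`). As `Y*(t) = a⁻¹ Ỹ(τ t)`, the identity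
follows once the law of `Ỹ(T)` is known not to depend on the realization.

Uniqueness in law is obtained without constructing solutions. The state-dependent drift is
decreasing in `z ≥ 0` and the regulator acts only at `0`, so the solution `z` is a Lipschitz
function of the driving path in the supremum norm (`IsRegulated.abs_sub_le`). The input
`Ỹ(T) = x(T) - x(0) - ∫₀ᵀ z^k` is then Lipschitz on each bounded set of paths for which a solution
exists, and a Lipschitz extension on each ball gives a Borel functional `Φ` on `C([0, T])` with
`Ỹ(T) = Φ(x)` for every solution (`exists_measurable_input`). The driving path is
`x = Z*(0) + √2 W` up to scaling, and its law is determined by independence and the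
finite-dimensional laws.

Square integrability follows from the polynomial bound `IsRegulated.abs_input_le` in terms of
`sup |x|`. The stationary law has all moments (`ParamTuple.memLp_id_stationaryLaw_base`), and so has
the supremum of a Brownian path, by Fernique's theorem (`memLp_norm_path`), whose hypothesis of
rotation invariance is a statement about two independent Brownian motions (`map_rotation_path`).
-/

namespace HeavyTraffic

/-! ### Pathwise analysis of the reflected equation -/

/-- The reflected integral equation of `IsReflectedSolution`, with complementarity restated as:
the regulator is constant on every interval `(u, v]` on which the path is positive. In this form
the conditions are plainly stable under scaling of space and time. -/
structure IsRegulated (c β : ℝ) (k : ℕ) (x z l : ℝ≥0 → ℝ) : Prop where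
  continuous_z : Continuous z
  continuous_l : Continuous l
  nonneg : ∀ t, 0 ≤ z t
  mono : Monotone l
  l_zero : l 0 = 0
  eqn : ∀ t : ℝ≥0,
    z t = x t - β * (∫ s in (0 : ℝ)..t, z s.toNNReal ^ k) + c * t + l t
  flat : ∀ u v, u ≤ v → (∀ r ∈ Set.Ioc u v, 0 < z r) → l v = l u

/-- A continuous monotone function does not increase over an interval that is null for its
Stieltjes measure. -/
theorem le_of_stieltjes_measure_Ioc_eq_zero {R : Type*} [LinearOrder R] [TopologicalSpace R]
    [OrderTopology R] [CompactIccSpace R] [MeasurableSpace R] [BorelSpace R]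
    [SecondCountableTopology R] [DenselyOrdered R] {l : R → ℝ} (hl : Monotone l)
    (hc : Continuous l) {u v : R} (h0 : hl.stieltjesFunction.measure (Set.Ioc u v) = 0) :
    l v ≤ l u := by
  have hf : ∀ t, hl.stieltjesFunction t = l t := fun t ↦
    (hl.stieltjesFunction_eq t).trans hc.continuousWithinAt.rightLim_eq
  rw [StieltjesFunction.measure_Ioc, hf, hf, ENNReal.ofReal_eq_zero] at h0
  linarith

theorem IsReflectedSolution.isRegulated {c β : ℝ} {k : ℕ} {x z l : ℝ≥0 → ℝ}
    (h : IsReflectedSolution c β k x z l) : IsRegulated c β k x z l where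
  continuous_z := h.continuous_z
  continuous_l := h.continuous_l
  nonneg := h.nonneg
  mono := h.mono
  l_zero := h.l_zero
  eqn := h.eqn
  flat u v huv hpos := by
    have h1 := le_of_stieltjes_measure_Ioc_eq_zero h.mono h.continuous_l
      (measure_mono_null hpos h.complementarity)
    exact le_antisymm (by linarith) (h.mono huv)

/-- The last time up to `t` at which a continuous function does not exceed the level `δ`. -/
theorem exists_last_le {G : ℝ≥0 → ℝ} (hG : Continuous G) {δ : ℝ} (h0 : G 0 ≤ δ) {t : ℝ≥0} :
    ∃ s, s ≤ t ∧ G s ≤ δ ∧ ∀ r ∈ Set.Ioc s t, δ < G r := by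
  have hc : IsCompact (Set.Icc 0 t ∩ {r | G r ≤ δ}) :=
    isCompact_Icc.inter_right (isClosed_le hG continuous_const)
  obtain ⟨s, hs, hmax⟩ := hc.exists_isGreatest ⟨0, ⟨le_rfl, zero_le⟩, h0⟩
  refine ⟨s, hs.1.2, hs.2, fun r hr ↦ ?_⟩
  by_contra! hle
  exact absurd (hmax ⟨⟨zero_le, hr.2⟩, hle⟩) (not_le.2 hr.1)

namespace IsRegulated

variable {c β : ℝ} {k : ℕ} {x x' z z' l l' : ℝ≥0 → ℝ}

theorem continuous_pow_toNNReal (h : IsRegulated c β k x z l) :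
    Continuous fun s : ℝ ↦ z s.toNNReal ^ k :=
  (h.continuous_z.comp continuous_real_toNNReal).pow k

theorem intervalIntegrable (h : IsRegulated c β k x z l) (a b : ℝ) :
    IntervalIntegrable (fun s : ℝ ↦ z s.toNNReal ^ k) volume a b :=
  h.continuous_pow_toNNReal.intervalIntegrable a b

theorem continuous_sub (h : IsRegulated c β k x z l) : Continuous fun t ↦ z t - x t := by
  have h1 : Continuous fun t : ℝ≥0 ↦ ∫ s in (0 : ℝ)..t, z s.toNNReal ^ k :=
    (intervalIntegral.continuous_primitive h.intervalIntegrable 0).comp NNReal.continuous_coe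
  have h2 : (fun t ↦ z t - x t) =
      fun t : ℝ≥0 ↦ -β * (∫ s in (0 : ℝ)..t, z s.toNNReal ^ k) + c * t + l t := by
    ext t
    have := h.eqn t
    linarith
  rw [h2]
  have := h.continuous_l
  fun_prop

theorem z_zero (h : IsRegulated c β k x z l) : z 0 = x 0 := by
  simpa [h.l_zero] using h.eqn 0

/-- The increment of a solution relative to its input. -/
theorem sub_sub_sub (h : IsRegulated c β k x z l) (s t : ℝ≥0) :
    (z t - x t) - (z s - x s) =
      -β * (∫ r in (s : ℝ)..t, z r.toNNReal ^ k) + c * (t - s) + (l t - l s) := by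
  rw [← intervalIntegral.integral_interval_sub_left (h.intervalIntegrable 0 t)
    (h.intervalIntegrable 0 s)]
  linear_combination h.eqn t - h.eqn s

/-- One half of the stability estimate: while `z - z'` exceeds its input difference by more than
`δ`, it is positive, so that `l` is constant and the drift pushes the paths together. -/
theorem sub_sub_sub_le (hβ : 0 ≤ β) (h : IsRegulated c β k x z l)
    (h' : IsRegulated c β k x' z' l') {T : ℝ≥0} {δ : ℝ} (hx : ∀ s ≤ T, |x s - x' s| ≤ δ)
    {t : ℝ≥0} (ht : t ≤ T) : (z t - x t) - (z' t - x' t) ≤ δ := by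
  by_contra! hlt
  have hδ : 0 ≤ δ := (abs_nonneg _).trans (hx 0 zero_le)
  obtain ⟨s, hst, hs, hr⟩ := exists_last_le
    (G := fun t ↦ (z t - x t) - (z' t - x' t)) (h.continuous_sub.sub h'.continuous_sub) (δ := δ)
    (t := t)
    (by simpa [h.z_zero, h'.z_zero] using hδ)
  have hz : ∀ r ∈ Set.Ioc s t, z' r < z r := fun r hr' ↦ by
    have h1 : δ < (z r - x r) - (z' r - x' r) := hr r hr'
    have h2 := (abs_le.1 (hx r (hr'.2.trans ht))).1
    linarith
  have hl := h.flat s t hst fun r hr' ↦ (h'.nonneg r).trans_lt (hz r hr')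
  have hl' := h'.mono hst
  have hint : ∫ r in (s : ℝ)..t, z' r.toNNReal ^ k ≤ ∫ r in (s : ℝ)..t, z r.toNNReal ^ k := by
    refine intervalIntegral.integral_mono_on_of_le_Ioo (by exact_mod_cast hst)
      (h'.intervalIntegrable _ _) (h.intervalIntegrable _ _) fun r hr' ↦ ?_
    have hmem : r.toNNReal ∈ Set.Ioc s t :=
      ⟨Real.lt_toNNReal_iff_coe_lt.2 hr'.1, Real.toNNReal_le_iff_le_coe.2 hr'.2.le⟩
    exact pow_le_pow_left₀ (h'.nonneg _) (hz _ hmem).le k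
  have e := h.sub_sub_sub s t
  have e' := h'.sub_sub_sub s t
  have := mul_le_mul_of_nonneg_left hint hβ
  have hs' : (z s - x s) - (z' s - x' s) ≤ δ := hs
  linarith

/-- The reflected equation depends on its driving path in a Lipschitz way, for the supremum norm. -/
theorem abs_sub_le (hβ : 0 ≤ β) (h : IsRegulated c β k x z l)
    (h' : IsRegulated c β k x' z' l') {T : ℝ≥0} {δ : ℝ} (hx : ∀ s ≤ T, |x s - x' s| ≤ δ)
    {t : ℝ≥0} (ht : t ≤ T) : |z t - z' t| ≤ 2 * δ := by
  have h1 := sub_sub_sub_le hβ h h' hx ht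
  have h2 := sub_sub_sub_le hβ h' h (fun s hs ↦ abs_sub_comm (x s) (x' s) ▸ hx s hs) ht
  have h3 := abs_le.1 (hx t ht)
  rw [abs_le]
  constructor <;> linarith

/-- A priori bound: since the last time at which `z ≤ M`, the regulator is constant and the
state-dependent drift is nonpositive. -/
theorem le_of_abs_le (hβ : 0 ≤ β) (h : IsRegulated c β k x z l) {T : ℝ≥0} {M : ℝ}
    (hx : ∀ s ≤ T, |x s| ≤ M) {t : ℝ≥0} (ht : t ≤ T) : z t ≤ 3 * M + |c| * T := by
  have hM : 0 ≤ M := (abs_nonneg _).trans (hx 0 zero_le)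
  have hcT : 0 ≤ |c| * T := by positivity
  by_contra! hlt
  obtain ⟨s, hst, hs, hr⟩ := exists_last_le h.continuous_z (δ := M)
    (t := t)
    (h.z_zero ▸ (abs_le.1 (hx 0 zero_le)).2)
  have hl := h.flat s t hst fun r hr' ↦ hM.trans_lt (hr r hr')
  have hst' : (s : ℝ) ≤ t := by exact_mod_cast hst
  have hint : 0 ≤ ∫ r in (s : ℝ)..t, z r.toNNReal ^ k :=
    intervalIntegral.integral_nonneg hst' fun r _ ↦ pow_nonneg (h.nonneg _) k
  have e := h.sub_sub_sub s t
  have h1 := (abs_le.1 (hx t ht)).2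
  have h2 := (abs_le.1 (hx s (hst.trans ht))).1
  have h3 : c * (t - s) ≤ |c| * T := by
    refine mul_le_mul (le_abs_self c) ?_ (by linarith) (abs_nonneg c)
    have : (t : ℝ) ≤ T := by exact_mod_cast ht
    linarith [s.coe_nonneg]
  have := mul_nonneg hβ hint
  linarith

/-- The input, net of the linear drift and the regulator, is the increment of the driving path
minus the accumulated state-dependent drift. -/
theorem sub_sub_eq (h : IsRegulated c β k x z l) (t : ℝ≥0) :
    z t - z 0 - c * t - l t = x t - x 0 - β * ∫ s in (0 : ℝ)..t, z s.toNNReal ^ k := by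
  linear_combination h.eqn t - h.z_zero

theorem abs_input_le (hβ : 0 ≤ β) (h : IsRegulated c β k x z l) {T : ℝ≥0} {M : ℝ}
    (hx : ∀ s ≤ T, |x s| ≤ M) :
    |z T - z 0 - c * T - l T| ≤ 2 * M + β * ((3 * M + |c| * T) ^ k * T) := by
  have hI : |∫ s in (0 : ℝ)..T, z s.toNNReal ^ k| ≤ (3 * M + |c| * T) ^ k * T := by
    have := intervalIntegral.norm_integral_le_of_norm_le_const (a := 0) (b := (T : ℝ))
      (f := fun s ↦ z s.toNNReal ^ k) (C := (3 * M + |c| * T) ^ k) fun s hs ↦ by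
        rw [Set.uIoc_of_le T.coe_nonneg] at hs
        rw [Real.norm_of_nonneg (pow_nonneg (h.nonneg _) k)]
        exact pow_le_pow_left₀ (h.nonneg _)
          (h.le_of_abs_le hβ hx (Real.toNNReal_le_iff_le_coe.2 hs.2)) k
    simpa using this
  rw [h.sub_sub_eq]
  have h1 := abs_le.1 (hx T le_rfl)
  have h2 := abs_le.1 (hx 0 zero_le)
  have h3 := abs_le.1 hI
  have h4 := mul_le_mul_of_nonneg_left h3.2 hβ
  have h5 := mul_le_mul_of_nonneg_left h3.1 hβ
  rw [abs_le]
  constructor <;> linarith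

/-- On bounded sets of driving paths, the input is a Lipschitz function of the driving path. The
Lipschitz constant grows with the bound `M` because `z ^ k` is only locally Lipschitz. -/
theorem abs_input_sub_le (hβ : 0 ≤ β) (h : IsRegulated c β k x z l)
    (h' : IsRegulated c β k x' z' l') {T : ℝ≥0} {M δ : ℝ} (hM : ∀ s ≤ T, |x s| ≤ M)
    (hM' : ∀ s ≤ T, |x' s| ≤ M) (hx : ∀ s ≤ T, |x s - x' s| ≤ δ) :
    |(z T - z 0 - c * T - l T) - (z' T - z' 0 - c * T - l' T)| ≤
      (2 + β * (k * (3 * M + |c| * T) ^ (k - 1) * 2 * T)) * δ := by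
  set R := 3 * M + |c| * T
  have hI : |∫ s in (0 : ℝ)..T, (z s.toNNReal ^ k - z' s.toNNReal ^ k)| ≤
      k * R ^ (k - 1) * (2 * δ) * T := by
    have := intervalIntegral.norm_integral_le_of_norm_le_const (a := 0) (b := (T : ℝ))
      (f := fun s ↦ z s.toNNReal ^ k - z' s.toNNReal ^ k)
      (C := k * R ^ (k - 1) * (2 * δ)) fun s hs ↦ by
        rw [Set.uIoc_of_le T.coe_nonneg] at hs
        have hs' := Real.toNNReal_le_iff_le_coe.2 hs.2
        have hR : 0 ≤ R := (h.nonneg _).trans (h.le_of_abs_le hβ hM hs')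
        have hmax : max |z s.toNNReal| |z' s.toNNReal| ≤ R := by
          rw [abs_of_nonneg (h.nonneg _), abs_of_nonneg (h'.nonneg _)]
          exact max_le (h.le_of_abs_le hβ hM hs') (h'.le_of_abs_le hβ hM' hs')
        calc |z s.toNNReal ^ k - z' s.toNNReal ^ k|
            ≤ |z s.toNNReal - z' s.toNNReal| * k *
                max |z s.toNNReal| |z' s.toNNReal| ^ (k - 1) := abs_pow_sub_pow_le _ _ k
          _ ≤ (2 * δ) * k * R ^ (k - 1) := by
              have h2 := abs_sub_le hβ h h' hx hs'
              have h3 : (0 : ℝ) ≤ 2 * δ := (abs_nonneg _).trans h2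
              gcongr
          _ = k * R ^ (k - 1) * (2 * δ) := by ring
    simpa using this
  rw [intervalIntegral.integral_sub (h.intervalIntegrable _ _) (h'.intervalIntegrable _ _)] at hI
  rw [h.sub_sub_eq, h'.sub_sub_eq]
  have h1 := abs_le.1 (hx T le_rfl)
  have h2 := abs_le.1 (hx 0 zero_le)
  have h3 := abs_le.1 hI
  have h4 := mul_le_mul_of_nonneg_left h3.2 hβ
  have h5 := mul_le_mul_of_nonneg_left h3.1 hβ
  rw [abs_le]
  constructor <;> linarith

/-- Scaling space by `a` and time by `τ` gives a solution with changed drift coefficients. -/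
theorem scale (h : IsRegulated c β k x z l) {a : ℝ} {τ : ℝ≥0} (ha : 0 < a) (hτ : 0 < τ) :
    IsRegulated (c * a / τ) (β * a / (τ * a ^ k)) k (fun t ↦ a * x (t / τ))
      (fun t ↦ a * z (t / τ)) (fun t ↦ a * l (t / τ)) where
  continuous_z := by have := h.continuous_z; fun_prop
  continuous_l := by have := h.continuous_l; fun_prop
  nonneg t := mul_nonneg ha.le (h.nonneg _)
  mono u v huv := mul_le_mul_of_nonneg_left (h.mono (by gcongr)) ha.le
  l_zero := by simp [h.l_zero]
  eqn t := by
    have hτ' : (0 : ℝ) < τ := hτ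
    have hI : ∫ s in (0 : ℝ)..t, (a * z (s.toNNReal / τ)) ^ k =
        a ^ k * (τ * ∫ s in (0 : ℝ)..(t / τ : ℝ≥0), z s.toNNReal ^ k) := by
      have h1 : ∀ s : ℝ, (a * z (s.toNNReal / τ)) ^ k =
          a ^ k * (fun s : ℝ ↦ z s.toNNReal ^ k) (s / τ) := fun s ↦ by
        simp only [mul_pow]
        rw [Real.toNNReal_div' τ.coe_nonneg, Real.toNNReal_coe]
      rw [intervalIntegral.integral_congr fun s _ ↦ h1 s, intervalIntegral.integral_const_mul,
        intervalIntegral.integral_comp_div (fun s : ℝ ↦ z s.toNNReal ^ k) hτ'.ne']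
      simp
    rw [hI]
    have e := h.eqn (t / τ)
    rw [e]
    push_cast
    field_simp
  flat u v huv hpos := by
    rw [h.flat (u / τ) (v / τ) (by gcongr) fun r hr ↦ ?_]
    have hmem : r * τ ∈ Set.Ioc u v :=
      ⟨(div_lt_iff₀ hτ).1 hr.1, (le_div_iff₀ hτ).1 hr.2⟩
    have := hpos _ hmem
    rw [mul_div_cancel_right₀ _ hτ.ne'] at this
    exact pos_of_mul_pos_right this ha.le

end IsRegulated

/-- The input of a solution is a Borel functional of the driving path. The paths for which a
solution exists need not form a measurable set: on each ball the input is Lipschitz on the part of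
the ball where it is defined, and extends to a Lipschitz function on the whole space. -/
theorem exists_measurable_input (c : ℝ) {β : ℝ} (hβ : 0 ≤ β) (k : ℕ) (T : ℝ≥0)
    [MeasurableSpace C(Set.Icc 0 T, ℝ)] [BorelSpace C(Set.Icc 0 T, ℝ)] :
    ∃ Φ : C(Set.Icc 0 T, ℝ) → ℝ, Measurable Φ ∧ ∀ (f : C(Set.Icc 0 T, ℝ)) (x z l : ℝ≥0 → ℝ),
      IsRegulated c β k x z l → (∀ s, f s = x s) → z T - z 0 - c * T - l T = Φ f := by
  classical
  let D : Set C(Set.Icc 0 T, ℝ) :=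
    {f | ∃ p : (ℝ≥0 → ℝ) × (ℝ≥0 → ℝ) × (ℝ≥0 → ℝ),
      IsRegulated c β k p.1 p.2.1 p.2.2 ∧ ∀ s, f s = p.1 s}
  choose! p hp using fun (f : C(Set.Icc 0 T, ℝ)) (hf : f ∈ D) ↦ hf
  let F : C(Set.Icc 0 T, ℝ) → ℝ := fun f ↦
    (p f).2.1 T - (p f).2.1 0 - c * T - (p f).2.2 T
  have key : ∀ (f g : C(Set.Icc 0 T, ℝ)) (q r : (ℝ≥0 → ℝ) × (ℝ≥0 → ℝ) × (ℝ≥0 → ℝ)) (M : ℝ),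
      IsRegulated c β k q.1 q.2.1 q.2.2 → (∀ s, f s = q.1 s) →
      IsRegulated c β k r.1 r.2.1 r.2.2 → (∀ s, g s = r.1 s) → ‖f‖ ≤ M → ‖g‖ ≤ M →
      |(q.2.1 T - q.2.1 0 - c * T - q.2.2 T) - (r.2.1 T - r.2.1 0 - c * T - r.2.2 T)| ≤
      (2 + β * (k * (3 * M + |c| * T) ^ (k - 1) * 2 * T)) * dist f g := by
    intro f g q r M hq hfq hr hgr hf hg
    refine hq.abs_input_sub_le hβ hr (fun s hs ↦ ?_) (fun s hs ↦ ?_) (fun s hs ↦ ?_)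
    · rw [← hfq ⟨s, zero_le, hs⟩]
      exact (f.norm_coe_le_norm _).trans hf
    · rw [← hgr ⟨s, zero_le, hs⟩]
      exact (g.norm_coe_le_norm _).trans hg
    · rw [← hfq ⟨s, zero_le, hs⟩, ← hgr ⟨s, zero_le, hs⟩]
      exact f.dist_apply_le_dist (g := g) _
  have hext : ∀ n : ℕ, ∃ Ψ : C(Set.Icc 0 T, ℝ) → ℝ, Measurable Ψ ∧
      Set.EqOn F Ψ (D ∩ {f | ‖f‖ ≤ n}) := by
    intro n
    have hLip : LipschitzOnWith (2 + β * (k * (3 * n + |c| * T) ^ (k - 1) * 2 * T)).toNNReal F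
        (D ∩ {f | ‖f‖ ≤ n}) := by
      refine LipschitzOnWith.of_dist_le_mul fun f hf g hg ↦ ?_
      rw [Real.coe_toNNReal _ (by positivity)]
      exact key f g (p f) (p g) n (hp f hf.1).1 (hp f hf.1).2 (hp g hg.1).1 (hp g hg.1).2 hf.2 hg.2
    obtain ⟨Ψ, hΨ, hF⟩ := hLip.extend_real
    exact ⟨Ψ, hΨ.continuous.measurable, hF⟩
  choose Ψ hΨ hF using hext
  refine ⟨fun f ↦ Ψ ⌈‖f‖⌉₊ f, ?_, fun f x z l h hfx ↦ ?_⟩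
  · exact (measurable_from_prod_countable_right (f := fun q ↦ Ψ q.1 q.2) hΨ).comp
      (((Nat.measurable_ceil.comp measurable_norm)).prodMk measurable_id)
  · have hf : f ∈ D := ⟨(x, z, l), h, hfx⟩
    change _ = Ψ ⌈‖f‖⌉₊ f
    rw [← hF ⌈‖f‖⌉₊ ⟨hf, Nat.le_ceil ‖f‖⟩, ← sub_eq_zero, ← abs_nonpos_iff]
    simpa using key f f (x, z, l) (p f) ‖f‖ h hfx (hp f hf).1 (hp f hf).2 le_rfl le_rfl

/-! ### Restriction of paths to a compact interval -/

/-- Restriction to `[0, T]`, from continuous paths to the space of continuous functions, extends to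
a map that is measurable for the product `σ`-algebra: evaluation along a dense sequence embeds the
Polish space of continuous functions measurably into a countable product. -/
theorem exists_measurable_restrict (T : ℝ≥0)
    [MeasurableSpace C(Set.Icc 0 T, ℝ)] [BorelSpace C(Set.Icc 0 T, ℝ)] :
    ∃ G : (ℝ≥0 → ℝ) → C(Set.Icc 0 T, ℝ), Measurable G ∧
      ∀ x : ℝ≥0 → ℝ, Continuous x → ∀ s, G x s = x s := by
  have : Nonempty (Set.Icc 0 T) := ⟨⟨0, le_rfl, zero_le⟩⟩
  let d := TopologicalSpace.denseSeq (Set.Icc 0 T)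
  let ι : C(Set.Icc 0 T, ℝ) → ℕ → ℝ := fun f n ↦ f (d n)
  have hι : Continuous ι := continuous_pi fun n ↦ continuous_eval_const _
  have hinj : Function.Injective ι := fun f g hfg ↦ by
    refine DFunLike.coe_injective ((TopologicalSpace.denseRange_denseSeq _).equalizer f.continuous
      g.continuous (funext fun n ↦ congrFun hfg n))
  obtain ⟨κ, hκ, hκι⟩ := (hι.measurableEmbedding hinj).exists_measurable_extend
    measurable_id fun _ ↦ ⟨0⟩
  refine ⟨fun x ↦ κ fun n ↦ x (d n), hκ.comp (by fun_prop), fun x hx s ↦ ?_⟩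
  exact DFunLike.congr_fun (congrFun hκι ⟨fun s ↦ x s, by fun_prop⟩) s

/-! ### Brownian motion: linear combinations and suprema -/

/-- Two independent real Gaussian processes are jointly Gaussian. -/
theorem isGaussianProcess_sumElim {Ω : Type*} [MeasurableSpace Ω] {P : Measure Ω}
    {S T : Type*} {X : S → Ω → ℝ} {Y : T → Ω → ℝ} (hX : IsGaussianProcess X P)
    (hY : IsGaussianProcess Y P) (h : IndepFun (fun ω s ↦ X s ω) (fun ω t ↦ Y t ω) P) :
    IsGaussianProcess (Sum.elim X Y) P where
  hasGaussianLaw I := by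
    have hind : IndepFun (fun ω ↦ I.toLeft.restrict (X · ω))
        (fun ω ↦ I.toRight.restrict (Y · ω)) P :=
      h.comp (Finset.measurable_restrict I.toLeft) (Finset.measurable_restrict I.toRight)
    let L : (I.toLeft → ℝ) × (I.toRight → ℝ) →L[ℝ] (I → ℝ) :=
      ContinuousLinearMap.pi fun i ↦ match i with
        | ⟨Sum.inl s, hs⟩ => (ContinuousLinearMap.proj (R := ℝ) (φ := fun _ : I.toLeft ↦ ℝ)
            ⟨s, Finset.mem_toLeft.2 hs⟩).comp (ContinuousLinearMap.fst ℝ _ _)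
        | ⟨Sum.inr t, ht⟩ => (ContinuousLinearMap.proj (R := ℝ) (φ := fun _ : I.toRight ↦ ℝ)
            ⟨t, Finset.mem_toRight.2 ht⟩).comp (ContinuousLinearMap.snd ℝ _ _)
    have hL : (fun ω ↦ I.restrict (Sum.elim X Y · ω)) =
        fun ω ↦ L (I.toLeft.restrict (X · ω), I.toRight.restrict (Y · ω)) := by
      ext ω ⟨i, hi⟩
      cases i <;> rfl
    rw [hL]
    exact (hind.hasGaussianLaw (hX.hasGaussianLaw _) (hY.hasGaussianLaw _)).map_fun L

section Combination

variable {Ω : Type*} [MeasurableSpace Ω] {P : Measure Ω} {X Y : ℝ≥0 → Ω → ℝ}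

/-- Linear combinations, with a common change of time, of two jointly Gaussian processes are
jointly Gaussian. -/
theorem isGaussianProcess_sumElim_combination
    (hXY : IsGaussianProcess (Sum.elim X Y) P) (p q p' q' : ℝ) (r : ℝ≥0) :
    IsGaussianProcess (Sum.elim (fun t ω ↦ p * X (r * t) ω + q * Y (r * t) ω)
      (fun t ω ↦ p' * X (r * t) ω + q' * Y (r * t) ω)) P := by
  have key : ∀ (a b : ℝ) (t : ℝ≥0), ∃ I : Finset (ℝ≥0 ⊕ ℝ≥0), ∃ L : (I → ℝ) →L[ℝ] ℝ, ∀ ω,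
      a * X (r * t) ω + b * Y (r * t) ω = L (I.restrict (Sum.elim X Y · ω)) := by
    intro a b t
    classical
    refine ⟨{Sum.inl (r * t), Sum.inr (r * t)},
      a • ContinuousLinearMap.proj ⟨Sum.inl (r * t), by simp⟩ +
      b • ContinuousLinearMap.proj ⟨Sum.inr (r * t), by simp⟩, fun ω ↦ by simp⟩
  refine hXY.of_isGaussianProcess ?_
  rintro (t | t)
  · exact key p q t
  · exact key p' q' t

theorem covariance_combination [IsProbabilityMeasure P] (hX : IsPreBrownianReal X P)
    (hY : IsPreBrownianReal Y P) (h : IndepFun (fun ω t ↦ X t ω) (fun ω t ↦ Y t ω) P)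
    (p q p' q' : ℝ) (s t : ℝ≥0) :
    cov[fun ω ↦ p * X s ω + q * Y s ω, fun ω ↦ p' * X t ω + q' * Y t ω; P] =
      (p * p' + q * q') * min s t := by
  have mX : ∀ u, MemLp (X u) 2 P := fun u ↦ (hX.isGaussianProcess.hasGaussianLaw_eval u).memLp_two
  have mY : ∀ u, MemLp (Y u) 2 P := fun u ↦ (hY.isGaussianProcess.hasGaussianLaw_eval u).memLp_two
  have hXY : ∀ u v, cov[X u, Y v; P] = 0 := fun u v ↦
    (h.comp (measurable_pi_apply u) (measurable_pi_apply v)).covariance_eq_zero (mX u) (mY v)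
  have cX := hX.covariance_fun_eval s t
  have cY := hY.covariance_fun_eval s t
  have h1 := hXY s t
  have h2 := hXY t s
  rw [covariance_comm] at h2
  change cov[(fun ω ↦ p * X s ω) + (fun ω ↦ q * Y s ω),
    (fun ω ↦ p' * X t ω) + (fun ω ↦ q' * Y t ω); P] = _
  rw [covariance_add_left, covariance_add_right, covariance_add_right]
  · simp only [covariance_const_mul_left, covariance_const_mul_right]
    rw [cX, cY]
    rw [h1, h2]
    ring
  all_goals first
    | exact (mX _).const_mul _
    | exact (mY _).const_mul _
    | exact ((mX _).const_mul _).add ((mY _).const_mul _)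

theorem isPreBrownianReal_combination [IsProbabilityMeasure P] (hX : IsPreBrownianReal X P)
    (hY : IsPreBrownianReal Y P) (h : IndepFun (fun ω t ↦ X t ω) (fun ω t ↦ Y t ω) P)
    {p q : ℝ} {r : ℝ≥0} (hpq : (p ^ 2 + q ^ 2) * r = 1) :
    IsPreBrownianReal (fun t ω ↦ p * X (r * t) ω + q * Y (r * t) ω) P := by
  have hG := isGaussianProcess_sumElim_combination
    (isGaussianProcess_sumElim hX.isGaussianProcess hY.isGaussianProcess h) p q p q r
  refine (hG.comp_right Sum.inl).isPreBrownianReal_of_covariance (fun t ↦ ?_) fun s t hst ↦ ?_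
  · simp only [Function.comp_apply, Sum.elim_inl]
    rw [integral_add ((hX.integrable_eval _).const_mul _) ((hY.integrable_eval _).const_mul _),
      integral_const_mul, integral_const_mul, hX.integral_eval, hY.integral_eval]
    simp
  · simp only [Function.comp_apply, Sum.elim_inl]
    rw [covariance_combination hX hY h, min_eq_left (by gcongr)]
    push_cast
    linear_combination (s : ℝ) * hpq

theorem isBrownianReal_combination [IsProbabilityMeasure P] (hX : IsBrownianReal X P)
    (hY : IsBrownianReal Y P) (h : IndepFun (fun ω t ↦ X t ω) (fun ω t ↦ Y t ω) P)
    {p q : ℝ} {r : ℝ≥0} (hpq : (p ^ 2 + q ^ 2) * r = 1) :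
    IsBrownianReal (fun t ω ↦ p * X (r * t) ω + q * Y (r * t) ω) P where
  toIsPreBrownianReal :=
    isPreBrownianReal_combination hX.toIsPreBrownianReal hY.toIsPreBrownianReal h hpq
  cont := by
    filter_upwards [hX.cont, hY.cont] with ω h1 h2
    fun_prop

/-- Rotating a pair of independent Brownian motions gives independent processes. -/
theorem indepFun_rotation [IsProbabilityMeasure P] (hX : IsPreBrownianReal X P)
    (hY : IsPreBrownianReal Y P) (h : IndepFun (fun ω t ↦ X t ω) (fun ω t ↦ Y t ω) P)
    (p q : ℝ) :
    IndepFun (fun ω t ↦ p * X t ω + q * Y t ω) (fun ω t ↦ -q * X t ω + p * Y t ω) P := by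
  have hG := isGaussianProcess_sumElim_combination
    (isGaussianProcess_sumElim hX.isGaussianProcess hY.isGaussianProcess h) p q (-q) p 1
  simp only [one_mul] at hG
  refine hG.indepFun_of_covariance_eq_zero (fun s ↦ hG.aemeasurable (Sum.inl s))
    (fun t ↦ hG.aemeasurable (Sum.inr t)) fun s t ↦ ?_
  rw [covariance_combination hX hY h]
  ring

end Combination

/-- The law of a Brownian motion on the path space does not depend on its realization. -/
theorem map_eq_of_isPreBrownianReal {Ω Ω' : Type*} [MeasurableSpace Ω] [MeasurableSpace Ω']
    {P : Measure Ω} {P' : Measure Ω'} [IsProbabilityMeasure P] [IsProbabilityMeasure P']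
    {W : ℝ≥0 → Ω → ℝ} {W' : ℝ≥0 → Ω' → ℝ} (hW : IsPreBrownianReal W P)
    (hW' : IsPreBrownianReal W' P') (mW : ∀ t, Measurable (W t)) (mW' : ∀ t, Measurable (W' t)) :
    P.map (fun ω t ↦ W t ω) = P'.map (fun ω t ↦ W' t ω) := by
  have h1 := isProjectiveLimit_map (P := P) (X := W) (measurable_pi_lambda _ mW).aemeasurable
  have h2 := isProjectiveLimit_map (P := P') (X := W') (measurable_pi_lambda _ mW').aemeasurable
  simp_rw [fun I ↦ (hW.hasLaw I).map_eq] at h1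
  simp_rw [fun I ↦ (hW'.hasLaw I).map_eq] at h2
  exact h1.unique h2

/-- The law of a Brownian path, as a random continuous function on `[0, T]`, is invariant under
rotations of pairs. -/
theorem map_rotation_path {Ω : Type*} [MeasurableSpace Ω] {P : Measure Ω} [IsProbabilityMeasure P]
    {W : ℝ≥0 → Ω → ℝ} (hW : IsBrownianReal W P) (mW : ∀ t, Measurable (W t)) {T : ℝ≥0}
    [MeasurableSpace C(Set.Icc 0 T, ℝ)] [BorelSpace C(Set.Icc 0 T, ℝ)]
    {G : (ℝ≥0 → ℝ) → C(Set.Icc 0 T, ℝ)} (hG : Measurable G)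
    (hGx : ∀ x : ℝ≥0 → ℝ, Continuous x → ∀ s, G x s = x s) (θ : ℝ) :
    ((P.map fun ω ↦ G (W · ω)).prod (P.map fun ω ↦ G (W · ω))).map
      (ContinuousLinearMap.rotation θ) =
    (P.map fun ω ↦ G (W · ω)).prod (P.map fun ω ↦ G (W · ω)) := by
  let W₁ : ℝ≥0 → Ω × Ω → ℝ := fun t ω ↦ W t ω.1
  let W₂ : ℝ≥0 → Ω × Ω → ℝ := fun t ω ↦ W t ω.2
  have mpW : Measurable fun ω t ↦ W t ω := measurable_pi_lambda _ mW
  have m₁ : ∀ t, Measurable (W₁ t) := fun t ↦ (mW t).comp measurable_fst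
  have m₂ : ∀ t, Measurable (W₂ t) := fun t ↦ (mW t).comp measurable_snd
  have b₁ : IsBrownianReal W₁ (P.prod P) :=
    { hasLaw I := (hW.hasLaw I).comp measurePreserving_fst.hasLaw
      cont := measurePreserving_fst.quasiMeasurePreserving.ae hW.cont }
  have b₂ : IsBrownianReal W₂ (P.prod P) :=
    { hasLaw I := (hW.hasLaw I).comp measurePreserving_snd.hasLaw
      cont := measurePreserving_snd.quasiMeasurePreserving.ae hW.cont }
  have hind : IndepFun (fun ω t ↦ W₁ t ω) (fun ω t ↦ W₂ t ω) (P.prod P) :=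
    indepFun_prod (X := fun ω t ↦ W t ω) (Y := fun ω t ↦ W t ω) mpW mpW
  let U : ℝ≥0 → Ω × Ω → ℝ := fun t ω ↦ Real.cos θ * W₁ t ω + Real.sin θ * W₂ t ω
  let V : ℝ≥0 → Ω × Ω → ℝ := fun t ω ↦ -Real.sin θ * W₁ t ω + Real.cos θ * W₂ t ω
  have mU : ∀ t, Measurable (U t) := fun t ↦ ((m₁ t).const_mul _).add ((m₂ t).const_mul _)
  have mV : ∀ t, Measurable (V t) := fun t ↦ ((m₁ t).const_mul _).add ((m₂ t).const_mul _)
  have bU : IsBrownianReal U (P.prod P) := by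
    simpa using isBrownianReal_combination b₁ b₂ hind (p := Real.cos θ) (q := Real.sin θ) (r := 1)
      (by simp)
  have bV : IsBrownianReal V (P.prod P) := by
    simpa [V] using isBrownianReal_combination b₁ b₂ hind (p := -Real.sin θ) (q := Real.cos θ)
      (r := 1) (by simp)
  have hUV : IndepFun (fun ω t ↦ U t ω) (fun ω t ↦ V t ω) (P.prod P) :=
    indepFun_rotation b₁.toIsPreBrownianReal b₂.toIsPreBrownianReal hind _ _
  have hlaw : ∀ B : ℝ≥0 → Ω × Ω → ℝ, IsBrownianReal B (P.prod P) → (∀ t, Measurable (B t)) →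
      (P.prod P).map (fun ω ↦ G (B · ω)) = P.map fun ω ↦ G (W · ω) := fun B hB mB ↦ by
    rw [← Function.comp_def G (fun ω t ↦ B t ω), ← Function.comp_def G (fun ω t ↦ W t ω),
      ← Measure.map_map hG (measurable_pi_lambda _ mB), ← Measure.map_map hG mpW,
      map_eq_of_isPreBrownianReal hB.toIsPreBrownianReal hW.toIsPreBrownianReal mB mW]
  have hmG : Measurable fun ω ↦ G (W · ω) := hG.comp mpW
  have hprod := (indepFun_iff_map_prod_eq_prod_map_map
    (hG.comp (measurable_pi_lambda _ mU)).aemeasurable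
    (hG.comp (measurable_pi_lambda _ mV)).aemeasurable).1 (hUV.comp hG hG)
  have hU := hlaw U bU mU
  have hV := hlaw V bV mV
  rw [Measure.map_prod_map _ _ hmG hmG, Measure.map_map (by fun_prop) (by fun_prop)]
  refine Eq.trans ?_ ((hprod.trans (congrArg₂ Measure.prod hU hV)).trans
    (Measure.map_prod_map _ _ hmG hmG))
  refine Measure.map_congr ?_
  filter_upwards [b₁.cont, b₂.cont] with ω h1 h2
  have hU' : Continuous (U · ω) := by fun_prop
  have hV' : Continuous (V · ω) := by fun_prop
  simp only [Function.comp_apply, Prod.map, ContinuousLinearMap.rotation_apply, Prod.mk.injEq]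
  constructor <;> ext s
  · rw [hGx _ hU']
    simp [hGx _ h1, hGx _ h2, U, W₁, W₂]
  · rw [hGx _ hV']
    simp [hGx _ h1, hGx _ h2, V, W₁, W₂]

/-- The supremum norm of a Brownian path over `[0, T]` has moments of all orders, by Fernique's
theorem for laws that are invariant under rotations of pairs. -/
theorem memLp_norm_path {Ω : Type*} [MeasurableSpace Ω] {P : Measure Ω} [IsProbabilityMeasure P]
    {W : ℝ≥0 → Ω → ℝ} (hW : IsBrownianReal W P) (mW : ∀ t, Measurable (W t)) {T : ℝ≥0}
    [MeasurableSpace C(Set.Icc 0 T, ℝ)] [BorelSpace C(Set.Icc 0 T, ℝ)]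
    {G : (ℝ≥0 → ℝ) → C(Set.Icc 0 T, ℝ)} (hG : Measurable G)
    (hGx : ∀ x : ℝ≥0 → ℝ, Continuous x → ∀ s, G x s = x s) (n : ℕ) :
    MemLp (fun ω ↦ ‖G (W · ω)‖) n P := by
  have hmG : Measurable fun ω ↦ G (W · ω) := hG.comp (measurable_pi_lambda _ mW)
  have : IsProbabilityMeasure (P.map fun ω ↦ G (W · ω)) :=
    Measure.isProbabilityMeasure_map hmG.aemeasurable
  obtain ⟨C, hC, hint⟩ := exists_integrable_exp_sq_of_map_rotation_eq_self
    (map_rotation_path hW mW hG hGx _)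
  have h2n : MemLp (fun f : C(Set.Icc 0 T, ℝ) ↦ ‖f‖) (2 * n : ℕ) (P.map fun ω ↦ G (W · ω)) := by
    rcases Nat.eq_zero_or_pos n with rfl | hn
    · simpa using aestronglyMeasurable_id.norm
    have h0 : ((2 * n : ℕ) : ENNReal) ≠ 0 := by exact_mod_cast (by omega : 2 * n ≠ 0)
    refine (integrable_norm_rpow_iff (by fun_prop) h0 (ENNReal.natCast_ne_top _)).1 ?_
    simp only [norm_norm, ENNReal.toReal_natCast, Real.rpow_natCast]
    refine (hint.const_mul (n.factorial / C ^ n)).mono' (by fun_prop) (ae_of_all _ fun f ↦ ?_)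
    have := Real.pow_div_factorial_le_exp (C * ‖f‖ ^ 2) (by positivity) n
    simp only [norm_norm, norm_pow]
    rw [div_le_iff₀ (by positivity), mul_pow, ← pow_mul] at this
    rw [div_mul_eq_mul_div, le_div_iff₀ (by positivity)]
    linarith
  exact ((memLp_map_measure_iff (by fun_prop) hmG.aemeasurable).1 h2n).mono_exponent
    (by exact_mod_cast (by omega : n ≤ 2 * n))

/-! ### Scaling of the parameters and of the stationary law -/

namespace ParamTuple

/-- The factor `σ = c_x² / (2μ)`, half the variance per unit time of the driving Brownian motion. -/
noncomputable def halfVar (Ξ : ParamTuple) : ℝ := Ξ.cxSq / (2 * Ξ.μ)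

/-- The factor `(β / σ)^{1/(k+1)}` by which space is scaled to reduce to the base tuple. -/
noncomputable def spaceScale (Ξ : ParamTuple) : ℝ := (Ξ.β / Ξ.halfVar) ^ (1 / ((Ξ.k : ℝ) + 1))

theorem continuous_stationaryWeight (Ξ : ParamTuple) : Continuous Ξ.stationaryWeight := by
  unfold stationaryWeight
  fun_prop

theorem measurable_stationaryDensity (Ξ : ParamTuple) : Measurable Ξ.stationaryDensity :=
  (Ξ.continuous_stationaryWeight.measurable.div_const _).indicator measurableSet_Ici

namespace Admissible

variable {Ξ : ParamTuple}

theorem cxSq_pos' (h : Ξ.Admissible) : 0 < Ξ.cxSq := h.cxSq_pos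

theorem halfVar_pos (h : Ξ.Admissible) : 0 < Ξ.halfVar :=
  div_pos h.cxSq_pos (mul_pos two_pos h.μ_pos)

theorem β_pos (h : Ξ.Admissible) : 0 < Ξ.β := div_pos h.Fk_pos (by positivity)

theorem spaceScale_pos (h : Ξ.Admissible) : 0 < Ξ.spaceScale :=
  Real.rpow_pos_of_pos (div_pos h.β_pos h.halfVar_pos) _

theorem spaceScale_pow (h : Ξ.Admissible) : Ξ.spaceScale ^ (Ξ.k + 1) = Ξ.β / Ξ.halfVar := by
  rw [spaceScale, ← Real.rpow_natCast, ← Real.rpow_mul (div_pos h.β_pos h.halfVar_pos).le]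
  push_cast
  rw [one_div_mul_cancel (by positivity), Real.rpow_one]

theorem τ_eq (h : Ξ.Admissible) : Ξ.τ = Ξ.halfVar * Ξ.spaceScale ^ 2 := by
  have hk : (Ξ.k : ℝ) + 1 ≠ 0 := by positivity
  rw [spaceScale, ← Real.rpow_natCast, ← Real.rpow_mul (div_pos h.β_pos h.halfVar_pos).le,
    Real.div_rpow h.β_pos.le h.halfVar_pos.le, τ]
  change Ξ.halfVar ^ _ * _ = _
  have e1 : ((Ξ.k : ℝ) - 1) / ((Ξ.k : ℝ) + 1) = 1 - 2 / ((Ξ.k : ℝ) + 1) := by field_simp; ring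
  have e2 : 1 / ((Ξ.k : ℝ) + 1) * (2 : ℕ) = 2 / ((Ξ.k : ℝ) + 1) := by push_cast; ring
  rw [e1, e2, Real.rpow_sub h.halfVar_pos, Real.rpow_one]
  ring

theorem τ_pos (h : Ξ.Admissible) : 0 < Ξ.τ := by
  rw [h.τ_eq]
  exact mul_pos h.halfVar_pos (pow_pos h.spaceScale_pos 2)

theorem cTilde_eq (h : Ξ.Admissible) : Ξ.cTilde = Ξ.c * Ξ.spaceScale / Ξ.τ := by
  have hk : (Ξ.k : ℝ) + 1 ≠ 0 := by positivity
  have h1 : Ξ.c * Ξ.spaceScale / Ξ.τ = Ξ.c * (Ξ.halfVar⁻¹ * Ξ.spaceScale⁻¹) := by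
    have := h.halfVar_pos.ne'
    have := h.spaceScale_pos.ne'
    rw [h.τ_eq]
    field_simp
  rw [h1, spaceScale, Real.div_rpow h.β_pos.le h.halfVar_pos.le, cTilde]
  change Ξ.c * Ξ.halfVar ^ _ * _ = _
  have e1 : -((Ξ.k : ℝ) / ((Ξ.k : ℝ) + 1)) = 1 / ((Ξ.k : ℝ) + 1) - 1 := by field_simp; ring
  rw [e1, Real.rpow_sub h.halfVar_pos, Real.rpow_one, Real.rpow_neg h.β_pos.le]
  have := (Real.rpow_pos_of_pos h.halfVar_pos (1 / ((Ξ.k : ℝ) + 1))).ne'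
  have := (Real.rpow_pos_of_pos h.β_pos (1 / ((Ξ.k : ℝ) + 1))).ne'
  have := h.halfVar_pos.ne'
  field_simp

theorem β_mul_spaceScale_div (h : Ξ.Admissible) :
    Ξ.β * Ξ.spaceScale / (Ξ.τ * Ξ.spaceScale ^ Ξ.k) = 1 := by
  have := h.halfVar_pos.ne'
  have ha := h.spaceScale_pos.ne'
  have e := h.spaceScale_pow
  rw [eq_div_iff this, pow_succ] at e
  rw [h.τ_eq, div_eq_one_iff_eq (by positivity)]
  rw [← e]
  ring

theorem stationaryWeight_eq (h : Ξ.Admissible) (x : ℝ) :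
    Ξ.stationaryWeight x = (base Ξ.cTilde Ξ.k).stationaryWeight (Ξ.spaceScale * x) := by
  have hσ := h.halfVar_pos.ne'
  have ha := h.spaceScale_pos.ne'
  have hf1 : (Nat.factorial Ξ.k : ℝ) ≠ 0 := by positivity
  have hf2 : (Nat.factorial (Ξ.k + 1) : ℝ) ≠ 0 := by positivity
  have e := h.spaceScale_pow
  have h1 : 2 * Ξ.μ / Ξ.cxSq = 1 / Ξ.halfVar := by
    have := h.μ_pos.ne'
    have := h.cxSq_pos'.ne'
    rw [halfVar]
    field_simp
  have h2 : Ξ.Fk = Ξ.β * (Nat.factorial Ξ.k : ℝ) := by rw [β]; field_simp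
  have h3 : Ξ.cTilde * Ξ.spaceScale = Ξ.c / Ξ.halfVar := by
    rw [h.cTilde_eq, h.τ_eq]
    field_simp
  have h4 : 2 * (base Ξ.cTilde Ξ.k).μ / (base Ξ.cTilde Ξ.k).cxSq = 1 := by
    norm_num [base, cxSq]
  rw [stationaryWeight, stationaryWeight, h4, h1, h2]
  simp only [base]
  congr 1
  rw [mul_pow, e, ← mul_assoc, h3]
  field_simp

theorem stationaryDensity_eq (h : Ξ.Admissible) (x : ℝ) : Ξ.stationaryDensity x =
    Ξ.spaceScale * (base Ξ.cTilde Ξ.k).stationaryDensity (Ξ.spaceScale * x) := by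
  have ha := h.spaceScale_pos
  have hI : ∫ y in Set.Ici 0, Ξ.stationaryWeight y = Ξ.spaceScale⁻¹ *
      ∫ y in Set.Ici 0, (base Ξ.cTilde Ξ.k).stationaryWeight y := by
    simp_rw [integral_Ici_eq_integral_Ioi, h.stationaryWeight_eq]
    rw [integral_comp_mul_left_Ioi _ _ ha]
    simp
  unfold stationaryDensity
  by_cases hx : 0 ≤ x
  · rw [Set.indicator_of_mem (show x ∈ Set.Ici 0 from hx),
      Set.indicator_of_mem (show Ξ.spaceScale * x ∈ Set.Ici 0 from mul_nonneg ha.le hx), hI,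
      h.stationaryWeight_eq]
    field_simp
  · rw [Set.indicator_of_notMem (show x ∉ Set.Ici 0 from hx),
      Set.indicator_of_notMem (fun hx' : Ξ.spaceScale * x ∈ Set.Ici 0 ↦
        hx (nonneg_of_mul_nonneg_right hx' ha)), mul_zero]

theorem base_admissible (c : ℝ) {k : ℕ} (hk : 1 ≤ k) : (base c k).Admissible where
  one_le_k := hk
  μ_pos := one_pos
  caSq_nonneg := zero_le_one
  csSq_nonneg := zero_le_one
  cxSq_pos := by norm_num [base]
  Fk_pos := by simp only [base]; positivity

/-- Scaling space turns the stationary law into that of the base tuple. -/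
theorem map_stationaryLaw (h : Ξ.Admissible) :
    Ξ.stationaryLaw.map (Ξ.spaceScale * ·) = (base Ξ.cTilde Ξ.k).stationaryLaw := by
  have ha := h.spaceScale_pos
  have hd : Measurable (base Ξ.cTilde Ξ.k).stationaryDensity :=
    (base Ξ.cTilde Ξ.k).measurable_stationaryDensity
  ext B hB
  rw [Measure.map_apply (by fun_prop) hB, stationaryLaw, stationaryLaw,
    withDensity_apply _ (measurableSet_preimage (by fun_prop) hB), withDensity_apply _ hB]
  simp_rw [h.stationaryDensity_eq, ENNReal.ofReal_mul ha.le]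
  rw [← setLIntegral_map (μ := volume) hB (f := fun y ↦ ENNReal.ofReal Ξ.spaceScale *
    ENNReal.ofReal ((base Ξ.cTilde Ξ.k).stationaryDensity y)) (by fun_prop) (by fun_prop),
    Real.map_volume_mul_left ha.ne', Measure.restrict_smul, lintegral_smul_measure,
    lintegral_const_mul _ (by fun_prop), smul_eq_mul, ← mul_assoc,
    abs_of_pos (inv_pos.2 ha), ← ENNReal.ofReal_mul (by positivity), inv_mul_cancel₀ ha.ne']
  simp

end Admissible

/-- The superlinear drift makes the stationary weight decay at least exponentially. -/
theorem stationaryWeight_base_le (c : ℝ) {k : ℕ} (hk : 1 ≤ k) :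
    ∃ C, ∀ x, 0 ≤ x → (base c k).stationaryWeight x ≤ C * Real.exp (-x) := by
  set R : ℝ := ((k : ℝ) + 1) * (|c| + 1) with hR
  have hR1 : 1 ≤ R := by
    have : (0 : ℝ) ≤ k := k.cast_nonneg
    nlinarith [abs_nonneg c]
  refine ⟨Real.exp ((|c| + 1) * R), fun x hx ↦ ?_⟩
  have h4 : 2 * (base c k).μ / (base c k).cxSq = 1 := by norm_num [base, cxSq]
  rw [stationaryWeight, h4, ← Real.exp_add, Real.exp_le_exp]
  have hf : (k.factorial : ℝ) / ((k + 1).factorial : ℝ) = 1 / ((k : ℝ) + 1) := by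
    rw [Nat.factorial_succ]
    push_cast
    field_simp
  simp only [base, hf, one_mul]
  have h1 : c * x ≤ |c| * x := mul_le_mul_of_nonneg_right (le_abs_self c) hx
  rcases le_total x R with hxR | hxR
  · have h2 : 0 ≤ 1 / ((k : ℝ) + 1) * x ^ (k + 1) := by positivity
    have h3 : (|c| + 1) * x ≤ (|c| + 1) * R := by gcongr
    linarith
  · have h2 : R ≤ x ^ k := hxR.trans (le_self_pow₀ (hR1.trans hxR) (by omega))
    have h3 : (|c| + 1) * x ≤ 1 / ((k : ℝ) + 1) * x ^ (k + 1) := by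
      rw [one_div_mul_eq_div, le_div_iff₀ (by positivity), pow_succ]
      calc (|c| + 1) * x * ((k : ℝ) + 1) = R * x := by rw [hR]; ring
        _ ≤ x ^ k * x := by gcongr
    have h5 : 0 ≤ (|c| + 1) * R := by positivity
    linarith

/-- The stationary law of a base tuple has moments of all orders. -/
theorem memLp_id_stationaryLaw_base (c : ℝ) {k : ℕ} (hk : 1 ≤ k) (n : ℕ) :
    MemLp (id : ℝ → ℝ) n (base c k).stationaryLaw := by
  rcases Nat.eq_zero_or_pos n with rfl | hn
  · simpa using aestronglyMeasurable_id
  refine (integrable_norm_rpow_iff (by fun_prop) (by exact_mod_cast hn.ne')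
    (ENNReal.natCast_ne_top _)).1 ?_
  have hd := (base c k).measurable_stationaryDensity
  rw [stationaryLaw, integrable_withDensity_iff (by fun_prop) (by simp)]
  simp only [id, ENNReal.toReal_natCast, Real.rpow_natCast]
  obtain ⟨C, hC⟩ := stationaryWeight_base_le c hk
  set I := ∫ y in Set.Ici 0, (base c k).stationaryWeight y with hI
  have hI0 : 0 ≤ I := integral_nonneg fun y ↦ (Real.exp_pos _).le
  have hG : IntegrableOn (fun x : ℝ ↦ C / I * (Real.exp (-x) * x ^ n)) (Set.Ici 0) := by
    refine Integrable.const_mul ?_ _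
    change IntegrableOn (fun x : ℝ ↦ Real.exp (-x) * x ^ n) (Set.Ici 0)
    rw [integrableOn_Ici_iff_integrableOn_Ioi]
    refine (Real.GammaIntegral_convergent (s := n + 1) (by positivity)).congr_fun
      (fun x hx ↦ ?_) measurableSet_Ioi
    simp
  refine (hG.integrable_indicator measurableSet_Ici).mono' (by fun_prop) (ae_of_all _ fun x ↦ ?_)
  unfold stationaryDensity
  by_cases hx : x ∈ Set.Ici 0
  · have hx' : 0 ≤ x := hx
    have hw : 0 ≤ (base c k).stationaryWeight x := (Real.exp_pos _).le
    rw [Set.indicator_of_mem hx, Set.indicator_of_mem hx, ← hI, norm_mul, norm_pow, norm_norm,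
      ENNReal.toReal_ofReal (div_nonneg hw hI0), Real.norm_of_nonneg hx',
      Real.norm_of_nonneg (div_nonneg hw hI0)]
    calc x ^ n * ((base c k).stationaryWeight x / I) ≤ x ^ n * (C * Real.exp (-x) / I) := by
          gcongr
          exact hC x hx'
      _ = C / I * (Real.exp (-x) * x ^ n) := by ring
  · rw [Set.indicator_of_notMem hx, Set.indicator_of_notMem hx]
    simp

end ParamTuple

/-! ### Normalized diffusions -/

/-- A stationary regulated diffusion in normalized form: the driving process is `√2` times a
standard Brownian motion `W`, the drift is `c - z ^ k`, and the initial state `ζ` is independent of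
`W` and has the stationary law of the base tuple. -/
structure IsNormalizedDiffusion {Ω : Type*} [MeasurableSpace Ω] (c : ℝ) (k : ℕ) (P : Measure Ω)
    (ζ : Ω → ℝ) (W z l : ℝ≥0 → Ω → ℝ) : Prop where
  measurable_initial : Measurable ζ
  measurable_W : ∀ t, Measurable (W t)
  brownian : IsBrownianReal W P
  indep : IndepFun ζ (fun ω t ↦ W t ω) P
  law_initial : HasLaw ζ (ParamTuple.base c k).stationaryLaw P
  solution : ∀ᵐ ω ∂P,
    IsRegulated c 1 k (fun t ↦ ζ ω + √2 * W t ω) (fun t ↦ z t ω) (fun t ↦ l t ω)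

namespace IsNormalizedDiffusion

variable {Ω Ω' : Type*} [MeasurableSpace Ω] [MeasurableSpace Ω'] {P : Measure Ω} {P' : Measure Ω'}
  [IsProbabilityMeasure P] [IsProbabilityMeasure P'] {c : ℝ} {k : ℕ} {ζ : Ω → ℝ} {ζ' : Ω' → ℝ}
  {W z l : ℝ≥0 → Ω → ℝ} {W' z' l' : ℝ≥0 → Ω' → ℝ}

/-- The law of the driving path is determined by `c` and `k`. -/
theorem identDistrib_driving (h : IsNormalizedDiffusion c k P ζ W z l)
    (h' : IsNormalizedDiffusion c k P' ζ' W' z' l') :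
    IdentDistrib (fun ω t ↦ ζ ω + √2 * W t ω) (fun ω t ↦ ζ' ω + √2 * W' t ω) P P' := by
  have mW := measurable_pi_lambda (fun ω t ↦ W t ω) h.measurable_W
  have mW' := measurable_pi_lambda (fun ω t ↦ W' t ω) h'.measurable_W
  have hpair : IdentDistrib (fun ω ↦ (ζ ω, fun t ↦ W t ω)) (fun ω ↦ (ζ' ω, fun t ↦ W' t ω))
      P P' := by
    refine ⟨(h.measurable_initial.prodMk mW).aemeasurable,
      (h'.measurable_initial.prodMk mW').aemeasurable, ?_⟩
    rw [(indepFun_iff_map_prod_eq_prod_map_map h.measurable_initial.aemeasurable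
        mW.aemeasurable).1 h.indep,
      (indepFun_iff_map_prod_eq_prod_map_map h'.measurable_initial.aemeasurable
        mW'.aemeasurable).1 h'.indep, h.law_initial.map_eq, h'.law_initial.map_eq,
      map_eq_of_isPreBrownianReal h.brownian.toIsPreBrownianReal h'.brownian.toIsPreBrownianReal
        h.measurable_W h'.measurable_W]
  exact hpair.comp (u := fun q : ℝ × (ℝ≥0 → ℝ) ↦ fun t ↦ q.1 + √2 * q.2 t) (by fun_prop)

/-- Uniqueness in law of the input: it is almost surely the value of one and the same measurable
functional at the driving path. -/
theorem identDistrib_input (h : IsNormalizedDiffusion c k P ζ W z l)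
    (h' : IsNormalizedDiffusion c k P' ζ' W' z' l') (T : ℝ≥0) :
    IdentDistrib (fun ω ↦ z T ω - z 0 ω - c * T - l T ω)
      (fun ω ↦ z' T ω - z' 0 ω - c * T - l' T ω) P P' := by
  borelize C(Set.Icc 0 T, ℝ)
  obtain ⟨G, hG, hGx⟩ := exists_measurable_restrict T
  obtain ⟨Φ, hΦ, hΦx⟩ := exists_measurable_input c zero_le_one k T
  have hid := (h.identDistrib_driving h').comp (hΦ.comp hG)
  have hae : (fun ω ↦ z T ω - z 0 ω - c * T - l T ω) =ᵐ[P]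
      (Φ ∘ G) ∘ fun ω t ↦ ζ ω + √2 * W t ω := by
    filter_upwards [h.solution, h.brownian.cont] with ω hs hc
    exact hΦx _ _ _ _ hs (hGx _ (by fun_prop))
  have hae' : (fun ω ↦ z' T ω - z' 0 ω - c * T - l' T ω) =ᵐ[P']
      (Φ ∘ G) ∘ fun ω t ↦ ζ' ω + √2 * W' t ω := by
    filter_upwards [h'.solution, h'.brownian.cont] with ω hs hc
    exact hΦx _ _ _ _ hs (hGx _ (by fun_prop))
  exact ⟨hid.aemeasurable_fst.congr hae.symm, hid.aemeasurable_snd.congr hae'.symm,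
    (Measure.map_congr hae).trans (hid.map_eq.trans (Measure.map_congr hae').symm)⟩

/-- The input grows at most polynomially in the supremum of the driving path, all of whose moments
are finite. -/
theorem memLp_input (hk : 1 ≤ k) (h : IsNormalizedDiffusion c k P ζ W z l) (T : ℝ≥0) :
    MemLp (fun ω ↦ z T ω - z 0 ω - c * T - l T ω) 2 P := by
  borelize C(Set.Icc 0 T, ℝ)
  obtain ⟨G, hG, hGx⟩ := exists_measurable_restrict T
  -- `M` dominates the driving path on `[0, T]`.
  let M : Ω → ℝ := fun ω ↦ |ζ ω| + √2 * ‖G (W · ω)‖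
  have hζ : ∀ n : ℕ, MemLp ζ n P := fun n ↦ by
    have := ParamTuple.memLp_id_stationaryLaw_base c hk n
    rw [← h.law_initial.map_eq] at this
    exact (memLp_map_measure_iff (by fun_prop) h.law_initial.aemeasurable).1 this
  have hM : ∀ n : ℕ, MemLp M n P := fun n ↦
    (hζ n).abs.add ((memLp_norm_path h.brownian h.measurable_W hG hGx n).const_mul _)
  have hpow : MemLp (fun ω ↦ (3 * M ω + |c| * T) ^ k) 2 P := by
    have h1 : MemLp (fun ω ↦ 3 * M ω + |c| * T) (2 * k : ℕ) P :=
      ((hM _).const_mul 3).add (memLp_const _)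
    have h2 := h1.norm_rpow_div (k : ENNReal)
    have hk0 : (k : ENNReal) ≠ 0 := by exact_mod_cast (by omega : k ≠ 0)
    have h3 : ((2 * k : ℕ) : ENNReal) / k = 2 := by
      push_cast
      exact ENNReal.mul_div_cancel_right hk0 (ENNReal.natCast_ne_top k)
    rw [h3] at h2
    refine h2.congr_norm (h1.aestronglyMeasurable.pow k) (ae_of_all _ fun ω ↦ ?_)
    simp
  have hbound : MemLp (fun ω ↦ 2 * M ω + 1 * ((3 * M ω + |c| * T) ^ k * T)) 2 P :=
    ((hM 2).const_mul 2).add ((hpow.mul_const _).const_mul _)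
  refine hbound.mono' (h.identDistrib_input h T).aemeasurable_fst.aestronglyMeasurable ?_
  filter_upwards [h.solution, h.brownian.cont] with ω hs hc
  refine hs.abs_input_le zero_le_one fun s hs' ↦ ?_
  calc |ζ ω + √2 * W s ω| ≤ |ζ ω| + √2 * |W s ω| := by
        refine (abs_add_le _ _).trans_eq ?_
        rw [abs_mul, abs_of_nonneg (Real.sqrt_nonneg 2)]
    _ ≤ M ω := by
        have h1 := (G (W · ω)).norm_coe_le_norm ⟨s, zero_le, hs'⟩
        rw [hGx _ hc] at h1
        exact add_le_add le_rfl (mul_le_mul_of_nonneg_left h1 (Real.sqrt_nonneg 2))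

end IsNormalizedDiffusion

namespace StationaryDiffusion

variable {Ξ : ParamTuple} {Ω : Type*} [MeasurableSpace Ω] {P : Measure Ω}

/-- Scaling space by `spaceScale` and time by `τ` puts a stationary diffusion in normalized form;
the two driving Brownian motions merge into a single one. -/
theorem exists_isNormalizedDiffusion [IsProbabilityMeasure P] (hΞ : Ξ.Admissible)
    (S : StationaryDiffusion Ξ P) :
    ∃ W : ℝ≥0 → Ω → ℝ, IsNormalizedDiffusion Ξ.cTilde Ξ.k P (fun ω ↦ Ξ.spaceScale * S.Z 0 ω) W
      (fun t ω ↦ Ξ.spaceScale * S.Z (t / Ξ.τ.toNNReal) ω)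
      (fun t ω ↦ Ξ.spaceScale * S.L (t / Ξ.τ.toNNReal) ω) := by
  have ha := hΞ.spaceScale_pos
  have hτ := hΞ.τ_pos
  have hμ := hΞ.μ_pos
  let r : ℝ≥0 := Ξ.μ.toNNReal / Ξ.τ.toNNReal
  -- `√2 W` is the scaled driving process, and `W` is `p` and `q` times the two Brownian motions.
  let p : ℝ := Ξ.spaceScale * Ξ.μ⁻¹ * √Ξ.caSq / √2
  let q : ℝ := Ξ.spaceScale * Ξ.μ⁻¹ * √Ξ.csSq / √2
  have hr : (r : ℝ) = Ξ.μ / Ξ.τ := by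
    simp [r, Real.coe_toNNReal _ hμ.le, Real.coe_toNNReal _ hτ.le]
  have hpq : (p ^ 2 + q ^ 2) * r = 1 := by
    have h1 : p ^ 2 + q ^ 2 = Ξ.spaceScale ^ 2 * Ξ.cxSq / (2 * Ξ.μ ^ 2) := by
      simp only [p, q, div_pow, mul_pow, Real.sq_sqrt hΞ.caSq_nonneg, Real.sq_sqrt hΞ.csSq_nonneg,
        Real.sq_sqrt zero_le_two, ParamTuple.cxSq]
      field_simp
    have := hΞ.cxSq_pos'.ne'
    rw [h1, hr, hΞ.τ_eq, ParamTuple.halfVar]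
    field_simp
  have hφ : Measurable fun b : (ℝ≥0 → ℝ) × (ℝ≥0 → ℝ) ↦ fun t ↦
      p * b.1 (r * t) + q * b.2 (r * t) := by fun_prop
  refine ⟨fun t ω ↦ p * S.Ba (r * t) ω + q * S.Bs (r * t) ω, ?_⟩
  refine
    { measurable_initial := (S.measurable_Z 0).const_mul _
      measurable_W t := ((S.measurable_Ba _).const_mul _).add ((S.measurable_Bs _).const_mul _)
      brownian := isBrownianReal_combination S.brownian_Ba S.brownian_Bs S.indep_Ba_Bs hpq
      indep := S.indep_initial.comp (measurable_const_mul Ξ.spaceScale) hφ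
      law_initial := ?_
      solution := ?_ }
  · refine ⟨((S.measurable_Z 0).const_mul _).aemeasurable, ?_⟩
    rw [← hΞ.map_stationaryLaw, ← S.law_initial.map_eq,
      Measure.map_map (by fun_prop) (S.measurable_Z 0)]
    rfl
  · filter_upwards [S.solution] with ω hω
    have h := hω.isRegulated.scale ha (Real.toNNReal_pos.2 hτ)
    rw [Real.coe_toNNReal _ hτ.le, hΞ.β_mul_spaceScale_div, ← hΞ.cTilde_eq] at h
    convert h using 2 with t
    have ht : (Ξ.μ * (t / Ξ.τ.toNNReal : ℝ≥0)).toNNReal = r * t := by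
      rw [Real.toNNReal_mul hμ.le, Real.toNNReal_coe, mul_div_left_comm, mul_comm]
    have h2 : √2 ≠ 0 := by positivity
    rw [ht]
    simp only [p, q]
    field_simp
    ring

/-- The input of a stationary diffusion in terms of that of its normalized form. -/
theorem Y_eq (hΞ : Ξ.Admissible) (S : StationaryDiffusion Ξ P) {t : ℝ} (ht : 0 ≤ t) :
    S.Y t = fun ω ↦ Ξ.spaceScale⁻¹ *
      (Ξ.spaceScale * S.Z ((Ξ.τ * t).toNNReal / Ξ.τ.toNNReal) ω
        - Ξ.spaceScale * S.Z (0 / Ξ.τ.toNNReal) ω - Ξ.cTilde * (Ξ.τ * t).toNNReal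
        - Ξ.spaceScale * S.L ((Ξ.τ * t).toNNReal / Ξ.τ.toNNReal) ω) := by
  have ha := hΞ.spaceScale_pos.ne'
  have hτ := hΞ.τ_pos
  have h1 : (Ξ.τ * t).toNNReal / Ξ.τ.toNNReal = t.toNNReal := by
    rw [Real.toNNReal_mul hτ.le, mul_div_cancel_left₀ _ (Real.toNNReal_pos.2 hτ).ne']
  ext ω
  rw [h1, zero_div, Real.coe_toNNReal _ (mul_nonneg hτ.le ht), hΞ.cTilde_eq, Y]
  field_simp

theorem v_zero (S : StationaryDiffusion Ξ P) : S.v 0 = 0 := by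
  have h : S.Y 0 =ᵐ[P] 0 := by
    filter_upwards [S.solution] with ω hω
    simp [Y, hω.l_zero]
  rw [v, variance_congr h, variance_zero]

end StationaryDiffusion

namespace ParamTuple

theorem base_spaceScale (c : ℝ) (k : ℕ) : (base c k).spaceScale = 1 := by
  have h1 : (base c k).β = 1 := by
    rw [β]
    exact div_self (by simp only [base]; positivity)
  have h2 : (base c k).halfVar = 1 := by norm_num [base, halfVar, cxSq]
  rw [spaceScale, h1, h2, div_one, Real.one_rpow]

theorem base_τ (c : ℝ) {k : ℕ} (hk : 1 ≤ k) : (base c k).τ = 1 := by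
  rw [(Admissible.base_admissible c hk).τ_eq, base_spaceScale]
  norm_num [base, halfVar, cxSq]

theorem base_cTilde (c : ℝ) {k : ℕ} (hk : 1 ≤ k) : (base c k).cTilde = c := by
  rw [(Admissible.base_admissible c hk).cTilde_eq, base_spaceScale, base_τ c hk]
  simp [base]

end ParamTuple

end HeavyTraffic

/-- For every realization `S` of the stationary diffusion with tuple `Ξ` and every realization `S₀`
with the base tuple `(c̃, k, 1, 1, 1, k!)`, possibly on another probability space, the variance of
`Y*(t)` is finite and `v(t; Ξ) = (c_x² / μ) t w_{c̃,k}(τ t)` for all `t ≥ 0`. -/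
theorem mainTheorem8 (Ξ : HeavyTraffic.ParamTuple) (hΞ : Ξ.Admissible)
    {Ω : Type*} [MeasurableSpace Ω] (P : MeasureTheory.Measure Ω)
    [MeasureTheory.IsProbabilityMeasure P]
    (S : HeavyTraffic.StationaryDiffusion Ξ P)
    {Ω₀ : Type*} [MeasurableSpace Ω₀] (P₀ : MeasureTheory.Measure Ω₀)
    [MeasureTheory.IsProbabilityMeasure P₀]
    (S₀ : HeavyTraffic.StationaryDiffusion (HeavyTraffic.ParamTuple.base Ξ.cTilde Ξ.k) P₀)
    (t : ℝ) (ht : 0 ≤ t) :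
    MeasureTheory.MemLp (S.Y t) 2 P ∧
      S.v t = Ξ.cxSq / Ξ.μ * t * S₀.w (Ξ.τ * t) := by
  have hk := hΞ.one_le_k
  have hτ := hΞ.τ_pos
  have ha := hΞ.spaceScale_pos.ne'
  have hbase := HeavyTraffic.ParamTuple.Admissible.base_admissible Ξ.cTilde hk
  obtain ⟨W, hN⟩ := S.exists_isNormalizedDiffusion hΞ
  obtain ⟨W₀, hN₀⟩ := S₀.exists_isNormalizedDiffusion hbase
  have hY := S.Y_eq hΞ ht
  have hY₀ := S₀.Y_eq hbase (mul_nonneg hτ.le ht)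
  rw [HeavyTraffic.ParamTuple.base_cTilde _ hk] at hN₀ hY₀
  rw [HeavyTraffic.ParamTuple.base_spaceScale, HeavyTraffic.ParamTuple.base_τ _ hk] at hY₀ hN₀
  simp only [inv_one, one_mul] at hY₀ hN₀
  refine ⟨hY ▸ (hN.memLp_input hk _).const_mul _, ?_⟩
  -- At `t = 0` the conventional value `w 0 = 1` is multiplied by zero.
  rcases ht.eq_or_lt with rfl | htpos
  · rw [S.v_zero]
    simp
  have hvar := (hN.identDistrib_input hN₀ (Ξ.τ * t).toNNReal).variance_eq
  have hv₀ : S₀.v (Ξ.τ * t) = _ := congrArg (fun f ↦ ProbabilityTheory.variance f P₀) hY₀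
  have hv : S.v t = _ := congrArg (fun f ↦ ProbabilityTheory.variance f P) hY
  rw [ProbabilityTheory.variance_const_mul, hvar, ← hv₀] at hv
  have hσ := hΞ.halfVar_pos.ne'
  have hcx : Ξ.cxSq / Ξ.μ = 2 * Ξ.halfVar := by
    have := hΞ.μ_pos.ne'
    rw [HeavyTraffic.ParamTuple.halfVar]
    field_simp
  rw [hv, HeavyTraffic.StationaryDiffusion.w, if_neg (mul_pos hτ htpos).ne', hcx, hΞ.τ_eq]
  field_simp
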